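/- Notation. $\mathbb N=\{1,2,3,\dots\}$. Let $\mathcal P_{<\infty}(\mathbb N)$ be the set of all finite subsets of $\mathbb N$, with the product topology inherited from $\{0,1\}^{\mathbb N}$. A set $K\subseteq\mathcal P_{<\infty}(\mathbb N)$ is hereditary if $A\subseteq B\in K$ implies $A\in K$. For a topological space $K$ let $K^{(0)}=K$, let $K^{(\gamma+1)}$ be the set of limit points of the space $K^{(\gamma)}$, and let $K^{(\gamma)}=\bigcap_{\delta<\gamma}K^{(\delta)}$ for limit ordinals $\gamma$. For finite sets, $A_1<\dots<A_k$ means that every element of $A_i$ is smaller than every element of $A_j$ whenever $i<j$ (the $A_i$ may be empty). Fix a countable limit ordinal $\alpha$, and let $I_\alpha$ be the set of limit ordinals $\gamma$ with $0<\gamma<\alpha$. Consider functions $b:I_\alpha\times\mathbb N\to\omega_1$ such that (1) for each $\gamma\in I_\alpha$, the sequence $(b(\gamma,n))_n$ is strictly increasing with supremum $\gamma$; (2) if $\gamma,\beta\in I_\alpha$, $n\in\mathbb N$ and $b(\beta,n)<\gamma<\beta$, then $b(\beta,n)<b(\gamma,1)$. Given such a $b$ and a strictly increasing $f:\mathbb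 N\to\mathbb N$, define families $\mathcal A^f_\beta\subseteq\mathcal P_{<\infty}(\mathbb N)$ for $\beta<\alpha$ by recursion: $\mathcal A^f_0=\{A:|A|\le 1\}$; the empty set belongs to every $\mathcal A^f_\beta$; a nonempty $A$ belongs to $\mathcal A^f_{\beta+1}$ if and only if $A=\bigcup_{i=1}^kA_i$ for some $A_1<\dots<A_k$ in $\mathcal A^f_\beta$ with $k\le f(\min A)$; and, for $\beta$ a limit ordinal, a nonempty $A$ belongs to $\mathcal A^f_\beta$ if and only if $A\in\mathcal A^f_{b(\beta,f(\min A))}$. Theorem. For every countable limit ordinal $\alpha$, functions $b$ with (1) and (2) exist. For every such $b$, the following holds. Let $\beta<\alpha$, and let $K$ be a compact, hereditary subset of $\mathcal P_{<\infty}(\mathbb N)$ with $K^{(\omega^\beta+1)}=\emptyset$. Then for every infinite $C\subseteq\mathbb N$ there exist an infinite $B\subseteq C$ and a strictly increasing $f:\mathbb N\to\mathbb N$ such that $A\cap B\in\mathcal A^f_\beta$ for all $A\in K$. -/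

import Mathlib

namespace SchreierSets

/-- The product topology on the finite subsets of `{1, 2, 3, …}`: the topology induced by
identifying a finite set with its characteristic function in `{0, 1}^ℕ`. -/
instance finsetTopology : TopologicalSpace (Finset ℕ+) :=
  TopologicalSpace.induced (fun (A : Finset ℕ+) (n : ℕ+) => decide (n ∈ A)) inferInstance

/-- The transfinite derived sets `K^(γ)` of a subset `K` of a topological space `X`, where `K`
carries the subspace topology: `K^(0) = K`, `K^(γ+1)` is the set of all limit points of the space
`K^(γ)`, and `K^(γ) = ⋂_{δ < γ} K^(δ)` at limit ordinals. -/
noncomputable def iteratedDerivedSet {X : Type*} [TopologicalSpace X] (K : Set X)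
    (γ : Ordinal.{0}) : Set X :=
  Ordinal.limitRecOn γ K (fun _ S => S ∩ derivedSet S)
    (fun γ _ S => ⋂ (δ : Ordinal.{0}) (h : δ < γ), S δ h)

/-- The two conditions on a function `b = b_α : I_α × ℕ → ω₁`, where `I_α` is the set of limit
ordinals below `α`. Values of `b` at ordinals outside `I_α` are irrelevant. -/
structure IsCoherentLadder (α : Ordinal.{0}) (b : Ordinal.{0} → ℕ+ → Ordinal.{0}) : Prop where
  strictMono : ∀ γ : Ordinal.{0}, Order.IsSuccLimit γ → γ < α → StrictMono (b γ)
  isLUB : ∀ γ : Ordinal.{0}, Order.IsSuccLimit γ → γ < α → IsLUB (Set.range (b γ)) γ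
  coherent : ∀ γ β : Ordinal.{0}, Order.IsSuccLimit γ → γ < α → Order.IsSuccLimit β → β < α →
    ∀ n : ℕ+, b β n < γ → γ < β → b β n < b γ 1

/-- The families `𝒜^f_β`, by transfinite recursion on `β`. The empty set belongs to all of them:
the conditions that mention `min A` are imposed for nonempty `A` only. The relation
`A₁ < ⋯ < A_k` means that all elements of `A_i` are smaller than all elements of `A_j` for `i < j`.
At a limit ordinal `β` the condition `b β (f (min A)) < β` is automatic if the sequence `b β`
strictly increases to `β`. -/
noncomputable def family (b : Ordinal.{0} → ℕ+ → Ordinal.{0}) (f : ℕ+ → ℕ+)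
    (β : Ordinal.{0}) : Set (Finset ℕ+) :=
  Ordinal.limitRecOn β
    {A | A.card ≤ 1}
    (fun _ S => {A | ∃ (k : ℕ) (D : Fin k → Finset ℕ+),
      (∀ i j, i < j → ∀ x ∈ D i, ∀ y ∈ D j, x < y) ∧
      (∀ i, D i ∈ S) ∧
      A = Finset.univ.biUnion D ∧
      ∀ hA : A.Nonempty, k ≤ (f (A.min' hA) : ℕ)})
    (fun β _ S => {A | ∀ hA : A.Nonempty,
      ∃ h : b β (f (A.min' hA)) < β, A ∈ S (b β (f (A.min' hA))) h})

open Classical in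
/-- The finite set `A ∩ B` for a finite set `A` and an arbitrary set `B`. -/
noncomputable def restrict (A : Finset ℕ+) (B : Set ℕ+) : Finset ℕ+ :=
  A.filter (fun n => n ∈ B)

end SchreierSets

namespace SchreierSets

open Filter Topology Ordinal Order

/-! ### Derivatives of families along one-point extensions -/

/-! As `n → ∞` the sets `insert n s` converge to `s`, so the derivative along one-point extensions
lies inside the topological one. It therefore suffices to know that `∅` is missing from the former
at order `ω ^ β + 1`; this is `HasLargeTraces`, proved by induction on `β`. All but finitely many
`{n}` are missing at order `ω ^ β`. For such `n` the link `{A | {n} ∪ A ∈ K}` loses `∅` already at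
an order `γ + 1` with `γ < ω ^ β`. If `β = δ + 1`, then `γ < ω ^ δ * m`, and `exists_blockUnion`
cuts the members of the link into at most `2 * m` blocks of level `δ`. If `β` is a limit, then `γ ≤
ω ^ b β m` for some `m`, and induction applies at level `b β m`. Restoring the point `n` costs one
more block; at limits, coherence of `b` absorbs this (`family_ladder_add_one_subset`). Each `n`
requires its own infinite set and its own `f`; `exists_diagonal` merges them. -/

/-- The transfinite derivative of `K` along one-point extensions: the members of `K` that have, for
each `δ < γ`, infinitely many one-point extensions in the `δ`-th derivative. -/
def extensionDerivative (K : Set (Finset ℕ+)) (γ : Ordinal.{0}) : Set (Finset ℕ+) :=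
  {s | s ∈ K ∧ ∀ δ, ∀ _h : δ < γ, {n | insert n s ∈ extensionDerivative K δ}.Infinite}
termination_by γ

theorem mem_extensionDerivative {K : Set (Finset ℕ+)} {γ : Ordinal.{0}} {s : Finset ℕ+} :
    s ∈ extensionDerivative K γ ↔
      s ∈ K ∧ ∀ δ < γ, {n | insert n s ∈ extensionDerivative K δ}.Infinite := by
  rw [extensionDerivative]; rfl

theorem extensionDerivative_anti (K : Set (Finset ℕ+)) : Antitone (extensionDerivative K) := by
  intro γ δ h s hs
  rw [mem_extensionDerivative] at hs ⊢
  exact ⟨hs.1, fun ε hε => hs.2 ε (hε.trans_le h)⟩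

theorem mem_extensionDerivative_add_one {K : Set (Finset ℕ+)} {γ : Ordinal.{0}} {s : Finset ℕ+} :
    s ∈ extensionDerivative K (γ + 1) ↔
      s ∈ K ∧ {n | insert n s ∈ extensionDerivative K γ}.Infinite := by
  rw [mem_extensionDerivative]
  refine and_congr_right fun _ => ⟨fun h => h γ (lt_add_one γ), fun h δ hδ => h.mono ?_⟩
  exact fun n hn => extensionDerivative_anti K (lt_add_one_iff.1 hδ) hn

theorem isLowerSet_extensionDerivative {K : Set (Finset ℕ+)} (hK : IsLowerSet K)
    (γ : Ordinal.{0}) : IsLowerSet (extensionDerivative K γ) := by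
  induction γ using WellFoundedLT.induction with
  | _ γ ih =>
    intro s t hts hs
    rw [mem_extensionDerivative] at hs ⊢
    refine ⟨hK hts hs.1, fun δ hδ => (hs.2 δ hδ).mono fun n hn => ?_⟩
    exact ih δ hδ (Finset.insert_subset_insert n hts) hn

/-- For `γ > 0` the derivative of order `γ` is the intersection of those of order `δ + 1` with `δ <
γ`, even when `γ` is a limit. -/
theorem exists_notMem_extensionDerivative_add_one {K : Set (Finset ℕ+)} {γ : Ordinal.{0}}
    {s : Finset ℕ+} (hγ : 0 < γ) (h : s ∉ extensionDerivative K γ) :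
    ∃ δ < γ, s ∉ extensionDerivative K (δ + 1) := by
  by_contra! H
  refine h (mem_extensionDerivative.2 ⟨(mem_extensionDerivative.1 (H 0 hγ)).1, fun δ hδ => ?_⟩)
  exact (mem_extensionDerivative_add_one.1 (H δ hδ)).2

theorem extensionDerivative_extensionDerivative_subset (K : Set (Finset ℕ+))
    (γ δ : Ordinal.{0}) :
    extensionDerivative (extensionDerivative K γ) δ ⊆ extensionDerivative K (γ + δ) := by
  induction δ using WellFoundedLT.induction with
  | _ δ ih =>
    intro s hs
    rw [mem_extensionDerivative] at hs
    have hs' := mem_extensionDerivative.1 hs.1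
    refine mem_extensionDerivative.2 ⟨hs'.1, fun ε hε => ?_⟩
    rcases lt_or_ge ε γ with h | h
    · exact hs'.2 ε h
    · obtain ⟨ζ, rfl⟩ : ∃ ζ, ε = γ + ζ := ⟨ε - γ, (Ordinal.add_sub_cancel_of_le h).symm⟩
      have hζ : ζ < δ := by simpa using hε
      exact (hs.2 ζ hζ).mono fun n hn => ih ζ hζ hn

theorem union_mem_extensionDerivative {K : Set (Finset ℕ+)} {s : Finset ℕ+} (γ : Ordinal.{0})
    {A : Finset ℕ+} (hA : A ∈ extensionDerivative {A | s ∪ A ∈ K} γ) :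
    s ∪ A ∈ extensionDerivative K γ := by
  induction γ using WellFoundedLT.induction generalizing A with
  | _ γ ih =>
    rw [mem_extensionDerivative] at hA ⊢
    refine ⟨hA.1, fun δ hδ => (hA.2 δ hδ).mono fun n hn => ?_⟩
    have := ih δ hδ hn
    rwa [Finset.union_insert] at this

theorem isLowerSet_setOf_union_mem {K : Set (Finset ℕ+)} (hK : IsLowerSet K) (s : Finset ℕ+) :
    IsLowerSet {A | s ∪ A ∈ K} :=
  fun _ _ hts hs => hK (Finset.union_subset_union_right hts) hs

theorem tendsto_insert_cofinite (s : Finset ℕ+) :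
    Tendsto (fun n => insert n s) cofinite (𝓝 s) := by
  rw [nhds_induced, tendsto_comap_iff, tendsto_pi_nhds]
  intro m
  refine tendsto_nhds_of_eventually_eq ?_
  filter_upwards [(Set.finite_singleton m).compl_mem_cofinite] with n hn
  have : m ≠ n := fun h => hn h.symm
  simp [this]

theorem accPt_of_infinite_insert_mem {S : Set (Finset ℕ+)} {s : Finset ℕ+}
    (h : {n | insert n s ∈ S}.Infinite) : AccPt s (𝓟 S) := by
  rw [accPt_iff_frequently]
  refine (tendsto_insert_cofinite s).frequently ?_
  -- The finitely many `n ∈ s` give `insert n s = s` and are discarded.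
  have h1 : ∃ᶠ n in cofinite, insert n s ∈ S := frequently_cofinite_iff_infinite.2 h
  refine (h1.and_eventually (s.finite_toSet.compl_mem_cofinite)).mono fun n hn => ⟨?_, hn.1⟩
  exact fun h => hn.2 (by simpa using h)

theorem extensionDerivative_subset_iteratedDerivedSet (K : Set (Finset ℕ+)) (γ : Ordinal.{0}) :
    extensionDerivative K γ ⊆ iteratedDerivedSet K γ := by
  induction γ using Ordinal.limitRecOn with
  | zero =>
    intro s hs
    rw [iteratedDerivedSet, limitRecOn_zero]
    exact (mem_extensionDerivative.1 hs).1
  | add_one γ ih =>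
    intro s hs
    rw [iteratedDerivedSet, limitRecOn_add_one]
    refine ⟨ih (extensionDerivative_anti K (lt_add_one γ).le hs), accPt_of_infinite_insert_mem ?_⟩
    exact (mem_extensionDerivative_add_one.1 hs).2.mono fun n hn => ih hn
  | limit γ hγ ih =>
    intro s hs
    rw [iteratedDerivedSet, limitRecOn_limit _ _ _ _ hγ]
    simp only [Set.mem_iInter]
    exact fun δ hδ => ih δ hδ (extensionDerivative_anti K hδ.le hs)

/-! ### Diagonalization -/

theorem exists_strictMono_ge (h : ℕ+ → ℕ) :
    ∃ f : ℕ+ → ℕ+, StrictMono f ∧ ∀ x, h x ≤ (f x : ℕ) := by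
  have key : ∀ x : ℕ+, h x + 1 ≤ ∑ y ∈ Finset.Iic x, (h y + 1) := fun x =>
    Finset.single_le_sum (f := fun y => h y + 1) (fun _ _ => Nat.zero_le _) (by simp)
  refine ⟨fun x => ⟨∑ y ∈ Finset.Iic x, (h y + 1), (Nat.succ_pos _).trans_le (key x)⟩, ?_, ?_⟩
  · intro x y hxy
    refine Subtype.mk_lt_mk.2 (Finset.sum_lt_sum_of_subset (i := y) ?_ ?_ ?_ ?_ ?_)
    · exact Finset.Iic_subset_Iic.2 hxy.le
    · simp
    · simpa using hxy
    · simp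
    · simp
  · exact fun x => (Nat.le_succ _).trans (key x)

/-- A fusion argument: choose `n₀ < n₁ < ⋯` and decreasing sets, the set chosen after `nᵢ`
satisfying `P nᵢ` with its own function. Since `i ≤ nᵢ`, a function dominating at each `x` the
finitely many functions of index `i ≤ x` dominates the `i`-th one from `nᵢ` on, which is all that
`mono` requires. -/
theorem exists_diagonal {P : ℕ+ → Set ℕ+ → (ℕ+ → ℕ+) → Prop}
    (mono : ∀ n B B' f f', B' ⊆ B → (∀ x, n ≤ x → f x ≤ f' x) → P n B f → P n B' f')
    {C : Set ℕ+} (hC : C.Infinite)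
    (ex : ∀ n ∈ C, ∀ D : Set ℕ+, D ⊆ C → D.Infinite → ∃ B ⊆ D, B.Infinite ∧ ∃ f, P n B f) :
    ∃ B ⊆ C, B.Infinite ∧ ∃ f : ℕ+ → ℕ+, StrictMono f ∧ ∀ n ∈ B, P n (B ∩ Set.Ioi n) f := by
  have step : ∀ D : {D : Set ℕ+ // D ⊆ C ∧ D.Infinite},
      ∃ n ∈ D.1, ∃ B : {D : Set ℕ+ // D ⊆ C ∧ D.Infinite}, B.1 ⊆ D.1 ∩ Set.Ioi n ∧
        ∃ f, P n B.1 f := by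
    rintro ⟨D, hDC, hD⟩
    obtain ⟨n, hn⟩ := hD.nonempty
    have hinf : (D ∩ Set.Ioi n).Infinite := by
      have := hD.sdiff (Set.finite_Iic n)
      rwa [Set.sdiff_eq, Set.compl_Iic] at this
    obtain ⟨B, hB, hBi, f, hf⟩ := ex n (hDC hn) _ (Set.inter_subset_left.trans hDC) hinf
    exact ⟨n, hn, ⟨B, hB.trans (Set.inter_subset_left.trans hDC), hBi⟩, hB, f, hf⟩
  choose ν hν β hβ φ hφ using step
  let D : ℕ → {D : Set ℕ+ // D ⊆ C ∧ D.Infinite} := fun i => β^[i] ⟨C, subset_rfl, hC⟩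
  have hD : ∀ i, D (i + 1) = β (D i) := fun i => Function.iterate_succ_apply' _ _ _
  have hanti : Antitone fun i => (D i).1 := antitone_nat_of_succ_le fun i => by
    rw [hD]; exact (hβ _).trans Set.inter_subset_left
  have hmono : StrictMono fun i => ν (D i) := strictMono_nat_of_lt_succ fun i => by
    have h := hν (D (i + 1))
    rw [hD] at h ⊢
    exact (hβ _ h).2
  obtain ⟨f, hf, hle⟩ :=
    exists_strictMono_ge fun x => ∑ i ∈ Finset.range (x + 1), (φ (D i) x : ℕ)
  refine ⟨Set.range fun i => ν (D i), ?_, Set.infinite_range_of_injective hmono.injective, f, hf, ?_⟩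
  · rintro _ ⟨i, rfl⟩
    exact (D i).2.1 (hν _)
  · rintro _ ⟨i, rfl⟩
    refine mono _ _ _ _ _ ?_ ?_ (hφ (D i))
    · rintro _ ⟨⟨j, rfl⟩, hj⟩
      have hij : i < j := hmono.lt_iff_lt.1 hj
      rw [← hD]
      exact hanti hij (hν (D j))
    · intro x hx
      have hix : i ≤ (x : ℕ) := by
        have h1 : StrictMono fun i => (ν (D i) : ℕ) := fun _ _ h => hmono h
        exact (h1.le_apply).trans hx
      refine PNat.coe_le_coe _ _ |>.1 (le_trans ?_ (hle x))
      exact Finset.single_le_sum (f := fun i => (φ (D i) x : ℕ)) (fun _ _ => Nat.zero_le _)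
        (Finset.mem_range.2 (Nat.lt_succ_of_le hix))

theorem exists_common {ι : Type*} {Q : ι → Set ℕ+ → (ℕ+ → ℕ+) → Prop}
    (mono : ∀ i B B' f f', B' ⊆ B → (∀ x, f x ≤ f' x) → Q i B f → Q i B' f')
    (ex : ∀ i, ∀ C : Set ℕ+, C.Infinite → ∃ B ⊆ C, B.Infinite ∧ ∃ f, Q i B f)
    (T : Finset ι) {C : Set ℕ+} (hC : C.Infinite) :
    ∃ B ⊆ C, B.Infinite ∧ ∃ f, ∀ i ∈ T, Q i B f := by
  classical
  induction T using Finset.induction_on with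
  | empty => exact ⟨C, subset_rfl, hC, id, by simp⟩
  | insert i T _ ih =>
    obtain ⟨B, hB, hBi, f, hf⟩ := ih
    obtain ⟨B', hB', hBi', f', hf'⟩ := ex i B hBi
    refine ⟨B', hB'.trans hB, hBi', fun x => max (f x) (f' x), fun j hj => ?_⟩
    rcases Finset.mem_insert.1 hj with rfl | hj
    · exact mono _ _ _ _ _ subset_rfl (fun x => le_max_right _ _) hf'
    · exact mono _ _ _ _ _ hB' (fun x => le_max_left _ _) (hf j hj)

/-! ### Unions of successive blocks -/

/-- The unions of at most `k` successive members of `S`. -/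
def blockUnion (S : Set (Finset ℕ+)) (k : ℕ) : Set (Finset ℕ+) :=
  {A | ∃ l : List (Finset ℕ+), l.length ≤ k ∧ l.Pairwise (fun D E => ∀ x ∈ D, ∀ y ∈ E, x < y) ∧
    (∀ D ∈ l, D ∈ S) ∧ ∀ x, x ∈ A ↔ ∃ D ∈ l, x ∈ D}

theorem empty_mem_blockUnion (S : Set (Finset ℕ+)) (k : ℕ) : ∅ ∈ blockUnion S k :=
  ⟨[], by simp, by simp, by simp, by simp⟩

theorem mem_blockUnion_one {S : Set (Finset ℕ+)} {A : Finset ℕ+} (hA : A ∈ S) :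
    A ∈ blockUnion S 1 :=
  ⟨[A], by simp, by simp, by simpa using hA, by simp⟩

theorem union_mem_blockUnion {S : Set (Finset ℕ+)} {j k : ℕ} {A B : Finset ℕ+}
    (hA : A ∈ blockUnion S j) (hB : B ∈ blockUnion S k) (h : ∀ x ∈ A, ∀ y ∈ B, x < y) :
    A ∪ B ∈ blockUnion S (j + k) := by
  obtain ⟨l, hl, hp, hS, hu⟩ := hA
  obtain ⟨l', hl', hp', hS', hu'⟩ := hB
  refine ⟨l ++ l', ?_, ?_, ?_, ?_⟩
  · rw [List.length_append]; omega
  · refine List.pairwise_append.2 ⟨hp, hp', fun D hD E hE x hx y hy => ?_⟩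
    exact h x ((hu x).2 ⟨D, hD, hx⟩) y ((hu' y).2 ⟨E, hE, hy⟩)
  · intro D hD
    rcases List.mem_append.1 hD with h | h
    exacts [hS D h, hS' D h]
  · intro x
    simp only [Finset.mem_union, hu, hu', List.mem_append, or_and_right, exists_or]

theorem blockUnion_mono {S T : Set (Finset ℕ+)} {k : ℕ} {A : Finset ℕ+}
    (h : ∀ D ⊆ A, D ∈ S → D ∈ T) (hA : A ∈ blockUnion S k) : A ∈ blockUnion T k := by
  obtain ⟨l, hl, hp, hS, hu⟩ := hA
  exact ⟨l, hl, hp, fun D hD => h D (fun x hx => (hu x).2 ⟨D, hD, hx⟩) (hS D hD), hu⟩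

/-! ### The families -/

theorem mem_family_zero {b : Ordinal.{0} → ℕ+ → Ordinal.{0}} {f : ℕ+ → ℕ+} {A : Finset ℕ+} :
    A ∈ family b f 0 ↔ A.card ≤ 1 := by
  rw [family, limitRecOn_zero]; rfl

theorem mem_family_add_one {b : Ordinal.{0} → ℕ+ → Ordinal.{0}} {f : ℕ+ → ℕ+} {β : Ordinal.{0}}
    {A : Finset ℕ+} : A ∈ family b f (β + 1) ↔
      ∃ k : ℕ, A ∈ blockUnion (family b f β) k ∧ ∀ hA : A.Nonempty, k ≤ (f (A.min' hA) : ℕ) := by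
  rw [family, limitRecOn_add_one]
  constructor
  · rintro ⟨k, D, hlt, hS, hu, hk⟩
    refine ⟨k, ⟨List.ofFn D, by simp, ?_, ?_, ?_⟩, hk⟩
    · exact List.pairwise_ofFn.2 fun i j hij => hlt i j hij
    · intro E hE
      obtain ⟨i, rfl⟩ := List.mem_ofFn.1 hE
      exact hS i
    · intro x
      simp [hu, List.mem_ofFn]
  · rintro ⟨k, ⟨l, hl, hp, hS, hu⟩, hk⟩
    refine ⟨l.length, l.get, ?_, ?_, ?_, fun hA => hl.trans (hk hA)⟩
    · exact fun i j hij => List.pairwise_iff_get.1 hp i j hij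
    · exact fun i => hS _ (List.get_mem l i)
    · ext x
      simp only [hu, Finset.mem_biUnion, Finset.mem_univ, true_and, List.mem_iff_get]
      simp

theorem mem_family_limit {b : Ordinal.{0} → ℕ+ → Ordinal.{0}} {f : ℕ+ → ℕ+} {β : Ordinal.{0}}
    (hβ : IsSuccLimit β) {A : Finset ℕ+} : A ∈ family b f β ↔ ∀ hA : A.Nonempty,
      b β (f (A.min' hA)) < β ∧ A ∈ family b f (b β (f (A.min' hA))) := by
  rw [family, limitRecOn_limit _ _ _ _ hβ]
  simp only [Set.mem_ofPred_eq, exists_prop]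
  rfl

theorem family_subset_family_add_one (b : Ordinal.{0} → ℕ+ → Ordinal.{0}) (f : ℕ+ → ℕ+)
    (β : Ordinal.{0}) : family b f β ⊆ family b f (β + 1) := fun _ hA =>
  mem_family_add_one.2 ⟨1, mem_blockUnion_one hA, fun _ => PNat.pos _⟩

theorem IsCoherentLadder.lt {α : Ordinal.{0}} {b : Ordinal.{0} → ℕ+ → Ordinal.{0}}
    (hb : IsCoherentLadder α b) {γ : Ordinal.{0}} (hγ : IsSuccLimit γ) (hα : γ < α) (n : ℕ+) :
    b γ n < γ :=
  (hb.strictMono γ hγ hα (PNat.lt_add_right n 1)).trans_le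
    ((hb.isLUB γ hγ hα).1 (Set.mem_range_self _))

theorem empty_mem_family (b : Ordinal.{0} → ℕ+ → Ordinal.{0}) (f : ℕ+ → ℕ+) (β : Ordinal.{0}) :
    ∅ ∈ family b f β := by
  induction β using Ordinal.limitRecOn with
  | zero => simp [mem_family_zero]
  | add_one β ih => exact family_subset_family_add_one b f β ih
  | limit β hβ ih => exact (mem_family_limit hβ).2 fun hA => absurd hA (by simp)

theorem singleton_mem_family {α : Ordinal.{0}} {b : Ordinal.{0} → ℕ+ → Ordinal.{0}}
    (hb : IsCoherentLadder α b) (f : ℕ+ → ℕ+) (n : ℕ+) {β : Ordinal.{0}} (hβ : β < α) :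
    {n} ∈ family b f β := by
  induction β using WellFoundedLT.induction with
  | _ β ih =>
    induction β using Ordinal.limitRecOn with
    | zero => simp [mem_family_zero]
    | add_one β _ =>
      exact family_subset_family_add_one b f β
        (ih β (lt_add_one β) ((lt_add_one β).trans hβ))
    | limit β hl _ =>
      refine (mem_family_limit hl).2 fun hA => ⟨hb.lt hl hβ _, ?_⟩
      exact ih _ (hb.lt hl hβ _) ((hb.lt hl hβ _).trans hβ)

/-- At a limit `γ`, coherence gives `b β m < b γ 1 ≤ b γ k` for every `k`, so whichever level `b γ
k` the minimum of `A` selects is still above `b β m` and induction applies. -/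
theorem family_ladder_add_one_subset {α : Ordinal.{0}} {b : Ordinal.{0} → ℕ+ → Ordinal.{0}}
    (hb : IsCoherentLadder α b) (f : ℕ+ → ℕ+) {β : Ordinal.{0}} (hl : IsSuccLimit β)
    (hβ : β < α) (m : ℕ+) {γ : Ordinal.{0}} (hm : b β m < γ) (hγ : γ < β) :
    family b f (b β m + 1) ⊆ family b f γ := by
  induction γ using WellFoundedLT.induction with
  | _ γ ih =>
    induction γ using Ordinal.limitRecOn with
    | zero => exact absurd hm not_lt_zero
    | add_one γ _ =>
      rcases (lt_add_one_iff.1 hm).eq_or_lt with h | h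
      · rw [h]
      · exact (ih γ (lt_add_one γ) h ((lt_add_one γ).trans hγ)).trans
          (family_subset_family_add_one b f γ)
    | limit γ hlγ _ =>
      intro A hA
      have hγα := hγ.trans hβ
      refine (mem_family_limit hlγ).2 fun hne => ⟨hb.lt hlγ hγα _, ?_⟩
      have h1 := hb.coherent γ β hlγ hγα hl hβ m hm hγ
      have hk := hb.lt hlγ hγα (f (A.min' hne))
      exact ih _ hk (h1.trans_le ((hb.strictMono γ hlγ hγα).monotone one_le))
        (hk.trans hγ) hA

theorem family_ladder_add_one_subset_of_lt {α : Ordinal.{0}} {b : Ordinal.{0} → ℕ+ → Ordinal.{0}}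
    (hb : IsCoherentLadder α b) (f : ℕ+ → ℕ+) {β : Ordinal.{0}} (hl : IsSuccLimit β)
    (hβ : β < α) {m k : ℕ+} (hmk : m < k) :
    family b f (b β m + 1) ⊆ family b f (b β k) :=
  family_ladder_add_one_subset hb f hl hβ m (hb.strictMono β hl hβ hmk) (hb.lt hl hβ k)

theorem family_mono {α : Ordinal.{0}} {b : Ordinal.{0} → ℕ+ → Ordinal.{0}}
    (hb : IsCoherentLadder α b) {β : Ordinal.{0}} (hβ : β < α) {f g : ℕ+ → ℕ+} {A : Finset ℕ+}
    (hfg : ∀ x ∈ A, f x ≤ g x) (hA : A ∈ family b f β) : A ∈ family b g β := by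
  induction β using WellFoundedLT.induction generalizing A with
  | _ β ih =>
    induction β using Ordinal.limitRecOn with
    | zero => simpa [mem_family_zero] using hA
    | add_one β _ =>
      obtain ⟨k, hk, hle⟩ := mem_family_add_one.1 hA
      refine mem_family_add_one.2 ⟨k, blockUnion_mono (fun D hD h => ?_) hk, fun hne => ?_⟩
      · exact ih β (lt_add_one β) ((lt_add_one β).trans hβ) (fun x hx => hfg x (hD hx)) h
      · exact (hle hne).trans (hfg _ (A.min'_mem hne))
    | limit β hl _ =>
      rw [mem_family_limit hl] at hA ⊢
      intro hne
      have hlt := hb.lt hl hβ (g (A.min' hne))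
      refine ⟨hlt, ih _ hlt (hlt.trans hβ) hfg ?_⟩
      -- A larger function value selects a higher level of the ladder, and coherence is what makes
      -- the families grow along it.
      rcases (hfg _ (A.min'_mem hne)).eq_or_lt with h | h
      · rw [← h]; exact (hA hne).2
      · exact family_ladder_add_one_subset_of_lt hb f hl hβ h
          (family_subset_family_add_one b f _ (hA hne).2)

/-! ### Existence of coherent ladders -/

theorem countable_Iio_of_lt_omega_one {α : Ordinal.{0}} (hα : α < ω_ 1) : (Set.Iio α).Countable := by
  rw [← Cardinal.le_aleph0_iff_set_countable, Cardinal.mk_Iio_ordinal, Cardinal.lift_le_aleph0,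
    ← Cardinal.lt_aleph_one_iff, ← Cardinal.lt_ord, Cardinal.ord_aleph]
  exact hα

theorem exists_strictMono_isLUB {γ : Ordinal.{0}} (hγ : IsSuccLimit γ)
    (hc : (Set.Iio γ).Countable) :
    ∃ u : ℕ → Ordinal.{0}, StrictMono u ∧ IsLUB (Set.range u) γ ∧ ∀ n, u n < γ := by
  have : Countable (Set.Iio γ) := hc
  have : Nonempty (Set.Iio γ) := ⟨⟨0, hγ.bot_lt⟩⟩
  obtain ⟨e, he⟩ := exists_surjective_nat (Set.Iio γ)
  let v : ℕ → Set.Iio γ := fun n => Nat.rec ⟨0, hγ.bot_lt⟩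
    (fun n x => ⟨max x.1 (e n).1 + 1, hγ.add_one_lt (max_lt x.2 (e n).2)⟩) n
  have hv : ∀ n, (v (n + 1)).1 = max (v n).1 (e n).1 + 1 := fun n => rfl
  refine ⟨fun n => (v n).1, strictMono_nat_of_lt_succ fun n => ?_, ⟨?_, ?_⟩, fun n => (v n).2⟩
  · rw [hv]
    exact (le_max_left _ _).trans_lt (lt_add_one _)
  · rintro _ ⟨n, rfl⟩
    exact (v n).2.le
  · intro x hx
    refine le_of_forall_lt fun y hy => ?_
    obtain ⟨n, hn⟩ := he ⟨y, hy⟩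
    have h1 : (v (n + 1)).1 ≤ x := hx ⟨n + 1, rfl⟩
    rw [hv, hn] at h1
    exact ((le_max_right _ _).trans_lt (lt_add_one _)).trans_le h1

/-- Inject the ordinals below `α` into `ℕ` by `e` and delete an initial piece of an arbitrary
cofinal sequence at each limit `γ`. Only finitely many `β` have `e β < e γ`, so the remaining terms
can be made to exceed every such `β < γ`, and every ladder term below `γ` of such a `β > γ`.
Coherence for `γ < β` follows from the choice at whichever of the two has the larger index. -/
theorem exists_isCoherentLadder {α : Ordinal.{0}} (hα : α < ω_ 1) :
    ∃ b : Ordinal.{0} → ℕ+ → Ordinal.{0}, IsCoherentLadder α b := by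
  have hc := countable_Iio_of_lt_omega_one hα
  obtain ⟨e, he⟩ := Set.countable_iff_exists_injOn.1 hc
  have hL : ∀ γ : Ordinal.{0}, ∃ u : ℕ → Ordinal.{0}, IsSuccLimit γ → γ < α →
      StrictMono u ∧ IsLUB (Set.range u) γ ∧ ∀ n, u n < γ := fun γ => by
    by_cases h : IsSuccLimit γ ∧ γ < α
    · obtain ⟨u, hu⟩ := exists_strictMono_isLUB h.1 (hc.mono (Set.Iio_subset_Iio h.2.le))
      exact ⟨u, fun _ _ => hu⟩
    · exact ⟨fun _ => 0, fun h1 h2 => absurd ⟨h1, h2⟩ h⟩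
  choose L hL using hL
  have hlt : ∀ γ, IsSuccLimit γ → γ < α → ∀ x < γ, ∃ n, x < L γ n := fun γ h1 h2 x hx => by
    obtain ⟨_, ⟨n, rfl⟩, hn⟩ := (lt_isLUB_iff (hL γ h1 h2).2.1).1 hx
    exact ⟨n, hn⟩
  have hprev : ∀ γ, {β | β < α ∧ e β < e γ}.Finite := fun γ => by
    refine Set.Finite.of_finite_image ((Set.finite_Iio (e γ)).subset ?_)
      (he.mono fun β hβ => hβ.1 : Set.InjOn e _)
    rintro _ ⟨β, hβ, rfl⟩
    exact hβ.2
  have hN : ∀ γ : Ordinal.{0}, ∃ N : ℕ, IsSuccLimit γ → γ < α →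
      (∀ β < γ, e β < e γ → β < L γ N) ∧
      (∀ β, γ < β → IsSuccLimit β → β < α → e β < e γ → ∀ n, L β n < γ → L β n < L γ N) := by
    intro γ
    by_cases h : IsSuccLimit γ ∧ γ < α
    swap
    · exact ⟨0, fun h1 h2 => absurd ⟨h1, h2⟩ h⟩
    have hev : ∀ x < γ, ∀ᶠ N in atTop, x < L γ N := fun x hx => by
      obtain ⟨n, hn⟩ := hlt γ h.1 h.2 x hx
      filter_upwards [eventually_ge_atTop n] with N hN
      exact hn.trans_le ((hL γ h.1 h.2).1.monotone hN)
    have h1 : ∀ᶠ N in atTop, ∀ β ∈ {β | β < α ∧ e β < e γ}, β < γ → β < L γ N :=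
      (eventually_all_finite (hprev γ)).2 fun β _ =>
        eventually_imp_distrib_left.2 fun hβ => hev β hβ
    have h2 : ∀ᶠ N in atTop, ∀ β ∈ {β | β < α ∧ e β < e γ}, γ < β ∧ IsSuccLimit β →
        ∀ n, L β n < γ → L β n < L γ N := by
      refine (eventually_all_finite (hprev γ)).2 fun β hβ =>
        eventually_imp_distrib_left.2 fun ⟨hγβ, hl⟩ => ?_
      -- The ladder of `β` eventually passes `γ < β`, so only finitely many of its terms matter.
      obtain ⟨k, hk⟩ := hlt β hl hβ.1 γ hγβ
      have h3 : ∀ᶠ N in atTop, ∀ n ∈ Set.Iio k, L β n < γ → L β n < L γ N :=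
        (eventually_all_finite (Set.finite_Iio k)).2 fun n _ =>
          eventually_imp_distrib_left.2 fun hn => hev _ hn
      filter_upwards [h3] with N hN n hn
      exact hN n ((hL β hl hβ.1).1.lt_iff_lt.1 (hn.trans hk)) hn
    obtain ⟨N, hN1, hN2⟩ := (h1.and h2).exists
    exact ⟨N, fun _ _ => ⟨fun β hβ heβ => hN1 β ⟨hβ.trans h.2, heβ⟩ hβ,
      fun β hγβ hl hβ heβ => hN2 β ⟨hβ, heβ⟩ ⟨hγβ, hl⟩⟩⟩
  choose N hN using hN
  have hshift : ∀ γ, IsSuccLimit γ → γ < α → ∀ n : ℕ+, L γ (N γ) < L γ (n + N γ) :=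
    fun γ h1 h2 n => (hL γ h1 h2).1 (Nat.lt_add_of_pos_left n.pos)
  refine ⟨fun γ n => L γ (n + N γ), fun γ h1 h2 => ?_, fun γ h1 h2 => ⟨?_, fun x hx => ?_⟩, ?_⟩
  · exact fun m n hmn => (hL γ h1 h2).1 (Nat.add_lt_add_right hmn _)
  · rintro _ ⟨n, rfl⟩
    exact ((hL γ h1 h2).2.2 _).le
  · refine (hL γ h1 h2).2.1.2 ?_
    rintro _ ⟨n, rfl⟩
    refine le_trans ((hL γ h1 h2).1.monotone ?_) (hx ⟨n.succPNat, rfl⟩)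
    simp only [Nat.succPNat_coe]
    omega
  · intro γ β hγl hγ hβl hβ n hn hγβ
    rcases lt_trichotomy (e γ) (e β) with h | h | h
    · exact absurd (hn.trans (((hN β hβl hβ).1 γ hγβ h).trans (hshift β hβl hβ n)))
        (lt_irrefl _)
    · exact absurd (he hγ hβ h) hγβ.ne
    · exact ((hN γ hγl hγ).2 β hγβ hβl hβ h _ hn).trans (hshift γ hγl hγ 1)

/-! ### Embedding into the families -/

/-- Every hereditary family whose derivative of order `ω ^ β + 1` is empty has traces in
`family b f β`, for a suitable `f`, on the subsets of some infinite subset of any infinite set. -/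
def HasLargeTraces (b : Ordinal.{0} → ℕ+ → Ordinal.{0}) (β : Ordinal.{0}) : Prop :=
  ∀ K : Set (Finset ℕ+), IsLowerSet K → ∅ ∉ extensionDerivative K (ω ^ β + 1) →
    ∀ C : Set ℕ+, C.Infinite → ∃ B ⊆ C, B.Infinite ∧ ∃ f : ℕ+ → ℕ+, StrictMono f ∧
      ∀ A ∈ K, ↑A ⊆ B → A ∈ family b f β

theorem exists_infinite_subset_of_notMem {K : Set (Finset ℕ+)} (hK : IsLowerSet K)
    {γ : Ordinal.{0}} (h : ∅ ∉ extensionDerivative K (γ + 1)) {C : Set ℕ+} (hC : C.Infinite) :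
    ∃ B ⊆ C, B.Infinite ∧ ∀ n ∈ B, {n} ∉ extensionDerivative K γ := by
  by_cases h0 : ∅ ∈ K
  · have hfin : {n | {n} ∈ extensionDerivative K γ}.Finite := by
      by_contra hinf
      exact h (mem_extensionDerivative_add_one.2 ⟨h0, hinf⟩)
    exact ⟨_, Set.sdiff_subset, hC.sdiff hfin, fun n hn => hn.2⟩
  · exact ⟨C, subset_rfl, hC, fun n _ hn =>
      h0 (hK (Finset.empty_subset _) (mem_extensionDerivative.1 hn).1)⟩

/-- Induction on `m`, with `L` the derivative of `K` of order `ω ^ δ`. Members of `L` need `2 * m`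
blocks. If `A ∉ L`, let `n` be the first point at which the initial segment of `A` leaves `L`: the
part before `n` needs `2 * m` blocks, `{n}` is one block, and the part after `n` is one more, since
it lies in the link of a set outside `L`. -/
theorem exists_blockUnion {α : Ordinal.{0}} {b : Ordinal.{0} → ℕ+ → Ordinal.{0}}
    (hb : IsCoherentLadder α b) {δ : Ordinal.{0}} (hδ : δ < α) (hT : HasLargeTraces b δ) (m : ℕ)
    {K : Set (Finset ℕ+)} (hK : IsLowerSet K)
    (h : ∅ ∉ extensionDerivative K (ω ^ δ * m + 1)) {C : Set ℕ+} (hC : C.Infinite) :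
    ∃ B ⊆ C, B.Infinite ∧ ∃ f : ℕ+ → ℕ+,
      ∀ A ∈ K, ↑A ⊆ B → A ∈ blockUnion (family b f δ) (2 * m) := by
  classical
  induction m generalizing K C with
  | zero =>
    obtain ⟨B, hB, hBi, hn⟩ := exists_infinite_subset_of_notMem hK h hC
    refine ⟨B, hB, hBi, id, fun A hA hAB => ?_⟩
    rcases A.eq_empty_or_nonempty with rfl | ⟨n, hnA⟩
    · exact empty_mem_blockUnion _ _
    · refine absurd ?_ (hn n (hAB hnA))
      refine mem_extensionDerivative.2 ⟨hK (Finset.singleton_subset_iff.2 hnA) hA, fun δ hδ => ?_⟩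
      simp at hδ
  | succ m ih =>
    -- One copy of `ω ^ δ` is split off on the left, because it is the first derivative to be taken.
    have hω : (ω ^ δ * ((m + 1 : ℕ) : Ordinal.{0}) + 1 : Ordinal.{0})
        = ω ^ δ + (ω ^ δ * m + 1) := by
      rw [← add_assoc, add_comm m 1, Nat.cast_add, Nat.cast_one, mul_add, mul_one]
    have hL := isLowerSet_extensionDerivative hK (ω ^ δ)
    rw [hω] at h
    obtain ⟨B₁, hB₁, hB₁i, f₁, hf₁⟩ := ih hL
      (fun h' => h (extensionDerivative_extensionDerivative_subset K _ _ h')) hC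
    -- Here `s` is a possible initial segment with elements at most `n`, and `A` a tail. There are
    -- only finitely many `s`, so one set and one function serve them all. The clause `f₁ n ≤ f n`
    -- keeps the decomposition of members of `L` valid for the new function.
    have hdiag := exists_diagonal (C := B₁)
      (P := fun n B f => f₁ n ≤ f n ∧ ∀ s ∈ (Finset.Iic n).powerset,
        s ∉ extensionDerivative K (ω ^ δ) →
        ∀ A : Finset ℕ+, ↑A ⊆ B → (∀ x ∈ A, n ≤ x) → s ∪ A ∈ K → A ∈ family b f δ) ?_ hB₁i ?_
    · obtain ⟨B, hB, hBi, f, -, hf⟩ := hdiag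
      refine ⟨B, hB.trans hB₁, hBi, f, fun A hA hAB => ?_⟩
      have hmono : ∀ D ∈ extensionDerivative K (ω ^ δ), D ⊆ A →
          D ∈ blockUnion (family b f δ) (2 * m) := fun D hD hDA =>
        blockUnion_mono (fun E hE h => family_mono hb hδ
          (fun x hx => (hf x (hAB (hDA (hE hx)))).1) h)
          (hf₁ D hD fun x hx => hB (hAB (hDA hx)))
      by_cases hAL : A ∈ extensionDerivative K (ω ^ δ)
      · obtain ⟨l, hl, h⟩ := hmono A hAL subset_rfl
        exact ⟨l, by omega, h⟩
      rcases A.eq_empty_or_nonempty with rfl | hne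
      · exact empty_mem_blockUnion _ _
      have hex : (A.filter fun n => A.filter (· ≤ n) ∉ extensionDerivative K (ω ^ δ)).Nonempty := by
        refine ⟨A.max' hne, Finset.mem_filter.2 ⟨A.max'_mem hne, ?_⟩⟩
        rwa [Finset.filter_true_of_mem fun x hx => A.le_max' x hx]
      obtain ⟨n, hn, hmin⟩ := Finset.exists_min_image _ id hex
      rw [Finset.mem_filter] at hn
      have h0 : A.filter (· < n) ∈ blockUnion (family b f δ) (2 * m) := by
        rcases (A.filter (· < n)).eq_empty_or_nonempty with he | he
        · rw [he]; exact empty_mem_blockUnion _ _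
        refine hmono _ ?_ (Finset.filter_subset _ _)
        by_contra hc
        have hmem := Finset.mem_filter.1 (Finset.max'_mem _ he)
        refine (hmem.2).not_ge (hmin _ (Finset.mem_filter.2 ⟨hmem.1, ?_⟩))
        convert hc using 2
        refine Finset.filter_congr fun x hx => ⟨fun h => h.trans_lt hmem.2, fun h => ?_⟩
        exact Finset.le_max' _ _ (Finset.mem_filter.2 ⟨hx, h⟩)
      have h2 : A.filter (n < ·) ∈ family b f δ := by
        refine (hf n (hAB hn.1)).2 (A.filter (· ≤ n)) ?_ hn.2 _ ?_ ?_ ?_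
        · exact Finset.mem_powerset.2 fun x hx => Finset.mem_Iic.2 (Finset.mem_filter.1 hx).2
        · intro x hx
          have := Finset.mem_filter.1 (Finset.mem_coe.1 hx)
          exact ⟨hAB this.1, this.2⟩
        · exact fun x hx => (Finset.mem_filter.1 hx).2.le
        · exact hK (Finset.union_subset (Finset.filter_subset _ _) (Finset.filter_subset _ _)) hA
      have hlast : ∀ x ∈ A.filter (· < n) ∪ {n}, ∀ y ∈ A.filter (n < ·), x < y := by
        intro x hx y hy
        have hy := (Finset.mem_filter.1 hy).2
        rcases Finset.mem_union.1 hx with hx | hx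
        · exact (Finset.mem_filter.1 hx).2.trans hy
        · rwa [Finset.mem_singleton.1 hx]
      have key := union_mem_blockUnion (union_mem_blockUnion h0
        (mem_blockUnion_one (singleton_mem_family hb f n hδ)) (by simp))
        (mem_blockUnion_one h2) hlast
      have hunion : A.filter (· < n) ∪ {n} ∪ A.filter (n < ·) = A := by
        ext x
        simp only [Finset.mem_union, Finset.mem_filter, Finset.mem_singleton]
        constructor
        · rintro ((h | rfl) | h)
          exacts [h.1, hn.1, h.1]
        · intro hx
          rcases lt_trichotomy x n with h | h | h <;> tauto
      rwa [hunion] at key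
    · intro n B B' f f' hB hf ⟨h1, h2⟩
      refine ⟨h1.trans (hf n le_rfl), fun s hs hsL A hA hnA hsA => ?_⟩
      exact family_mono hb hδ (fun x hx => hf x (hnA x hx)) (h2 s hs hsL A (hA.trans hB) hnA hsA)
    · intro n _ D _ hD
      obtain ⟨B, hB, hBi, f, hf⟩ := exists_common
        (Q := fun s B f => s ∉ extensionDerivative K (ω ^ δ) →
          ∀ A : Finset ℕ+, ↑A ⊆ B → s ∪ A ∈ K → A ∈ family b f δ)
        (fun s B B' f f' hB hf h hs A hA hsA =>
          family_mono hb hδ (fun x _ => hf x) (h hs A (hA.trans hB) hsA))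
        (fun s C hC => by
          by_cases hs : s ∈ extensionDerivative K (ω ^ δ)
          · exact ⟨C, subset_rfl, hC, id, fun h => absurd hs h⟩
          obtain ⟨B, hB, hBi, f, -, hf⟩ := hT _ (isLowerSet_setOf_union_mem hK s) (fun h => hs (by
            have := union_mem_extensionDerivative _ h
            rw [Finset.union_empty] at this
            exact extensionDerivative_anti K (lt_add_one _).le this)) C hC
          exact ⟨B, hB, hBi, f, fun _ A hAB hA => hf A hA hAB⟩)
        (Finset.Iic n).powerset hD
      refine ⟨B, hB, hBi, fun x => max (f₁ x) (f x), le_max_left _ _, ?_⟩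
      exact fun s hs hsL A hA _ hsA =>
        family_mono hb hδ (fun x _ => le_max_right _ _) (hf s hs hsL A hA hsA)

theorem insert_mem_family_add_one {α : Ordinal.{0}} {b : Ordinal.{0} → ℕ+ → Ordinal.{0}}
    (hb : IsCoherentLadder α b) {δ : Ordinal.{0}} (hδ : δ < α) {f : ℕ+ → ℕ+} {k n : ℕ+}
    {A : Finset ℕ+} (hA : A ∈ blockUnion (family b f δ) k) (hn : ∀ x ∈ A, n < x) :
    {n} ∪ A ∈ family b (fun x => f x + (1 + k)) (δ + 1) := by
  have h1 := union_mem_blockUnion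
    (mem_blockUnion_one (singleton_mem_family hb f n hδ)) hA (by simpa using hn)
  refine mem_family_add_one.2 ⟨_, blockUnion_mono (fun D _ hD => ?_) h1, fun _ => ?_⟩
  · exact family_mono hb hδ (fun x _ => (PNat.lt_add_right _ _).le) hD
  · simp only [PNat.add_coe, PNat.one_coe]
    omega

theorem exists_union_mem_family {α : Ordinal.{0}} {b : Ordinal.{0} → ℕ+ → Ordinal.{0}}
    (hb : IsCoherentLadder α b) {β : Ordinal.{0}} (hβ : β < α)
    (ih : ∀ δ < β, HasLargeTraces b δ) {K : Set (Finset ℕ+)} (hK : IsLowerSet K) {n : ℕ+}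
    (hn : {n} ∉ extensionDerivative K (ω ^ β)) {C : Set ℕ+} (hC : C.Infinite) :
    ∃ B ⊆ C, B.Infinite ∧ ∃ f : ℕ+ → ℕ+, ∀ A : Finset ℕ+, ↑A ⊆ B → (∀ x ∈ A, n < x) →
      {n} ∪ A ∈ K → {n} ∪ A ∈ family b f β := by
  have hKn := isLowerSet_setOf_union_mem hK {n}
  have h0 : ∅ ∉ extensionDerivative {A | {n} ∪ A ∈ K} (ω ^ β) := fun h =>
    hn (by simpa using union_mem_extensionDerivative _ h)
  obtain ⟨γ, hγ, hγK⟩ := exists_notMem_extensionDerivative_add_one (opow_pos β omega0_pos) h0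
  induction β using Ordinal.limitRecOn with
  | zero =>
    obtain rfl : γ = 0 := by simpa using hγ
    obtain ⟨B, hB, hBi, h⟩ := exists_infinite_subset_of_notMem hKn hγK hC
    refine ⟨B, hB, hBi, id, fun A hAB _ hA => ?_⟩
    rcases A.eq_empty_or_nonempty with rfl | ⟨x, hx⟩
    · simp [mem_family_zero]
    · refine absurd ?_ (h x (hAB hx))
      refine mem_extensionDerivative.2 ⟨hKn (Finset.singleton_subset_iff.2 hx) hA, fun δ hδ => ?_⟩
      exact absurd hδ not_lt_zero
  | add_one δ _ =>
    have hδ := (lt_add_one δ).trans hβ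
    -- `ω ^ (δ + 1)` is the supremum of the `ω ^ δ * m`.
    rw [opow_add, opow_one, lt_mul_iff_of_isSuccLimit isSuccLimit_omega0] at hγ
    obtain ⟨c, hc, hγc⟩ := hγ
    obtain ⟨m, rfl⟩ := lt_omega0.1 hc
    obtain ⟨B, hB, hBi, f, hf⟩ := exists_blockUnion hb hδ (ih δ (lt_add_one δ)) m hKn
      (fun h => hγK (extensionDerivative_anti _ (by gcongr) h)) hC
    refine ⟨B, hB, hBi, fun x => f x + (1 + (2 * m).succPNat), fun A hAB hnA hA => ?_⟩
    obtain ⟨l, hl, h⟩ := hf A hA hAB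
    exact insert_mem_family_add_one hb hδ ⟨l, hl.trans (Nat.le_succ _), h⟩ hnA
  | limit β hl _ =>
    obtain ⟨δ, hδ, hγδ⟩ := (lt_opow_of_isSuccLimit omega0_ne_zero hl).1 hγ
    obtain ⟨_, ⟨m, rfl⟩, hm⟩ := (lt_isLUB_iff (hb.isLUB β hl hβ)).1 hδ
    have hlt := hb.lt hl hβ m
    have hle : γ ≤ ω ^ b β m :=
      hγδ.le.trans (opow_le_opow_right omega0_pos hm.le)
    obtain ⟨B, hB, hBi, f, -, hf⟩ := ih (b β m) hlt _ hKn
      (fun h => hγK (extensionDerivative_anti _ (by gcongr) h)) C hC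
    -- The summand `1 + 1` pays for the blocks `{n}` and `A`, which puts `{n} ∪ A` at level `b β m +
    -- 1`; the summand `m` makes the selected index exceed `m`, so that the selected family contains
    -- that level.
    refine ⟨B, hB, hBi, fun x => f x + (1 + 1) + m, fun A hAB hnA hA => ?_⟩
    have h1 := insert_mem_family_add_one hb (k := 1) (hlt.trans hβ)
      (mem_blockUnion_one (hf A hA hAB)) hnA
    have hsucc : b β m + 1 < α := (hl.add_one_lt hlt).trans hβ
    refine (mem_family_limit hl).2 fun _ => ⟨hb.lt hl hβ _, ?_⟩
    exact family_ladder_add_one_subset_of_lt hb _ hl hβ (PNat.lt_add_left m _)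
      (family_mono hb hsucc (fun x _ => (PNat.lt_add_right _ _).le) h1)

theorem hasLargeTraces {α : Ordinal.{0}} {b : Ordinal.{0} → ℕ+ → Ordinal.{0}}
    (hb : IsCoherentLadder α b) {β : Ordinal.{0}} (hβ : β < α) : HasLargeTraces b β := by
  induction β using WellFoundedLT.induction with
  | _ β ih =>
    intro K hK h C hC
    obtain ⟨C', hC', hC'i, hn⟩ := exists_infinite_subset_of_notMem hK h hC
    obtain ⟨B, hB, hBi, f, hf, hP⟩ := exists_diagonal (C := C')
      (P := fun n B f => ∀ A : Finset ℕ+, ↑A ⊆ B → (∀ x ∈ A, n < x) →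
        {n} ∪ A ∈ K → {n} ∪ A ∈ family b f β)
      (fun n B B' f f' hB hf h A hA hnA hnK => family_mono hb hβ (fun x hx => hf x (by
        rcases Finset.mem_union.1 hx with hx | hx
        · exact (Finset.mem_singleton.1 hx).ge
        · exact (hnA x hx).le)) (h A (hA.trans hB) hnA hnK))
      hC'i (fun n hnC D _ hD => exists_union_mem_family hb hβ
        (fun δ hδ => ih δ hδ (hδ.trans hβ)) hK (hn n hnC) hD)
    refine ⟨B, hB.trans hC', hBi, f, hf, fun A hA hAB => ?_⟩
    rcases A.eq_empty_or_nonempty with rfl | hne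
    · exact empty_mem_family b f β
    have hmem := A.min'_mem hne
    have hlt : ∀ x ∈ A.erase (A.min' hne), A.min' hne < x := fun x hx =>
      A.min'_lt_of_mem_erase_min' hne hx
    have hunion : {A.min' hne} ∪ A.erase (A.min' hne) = A := by
      rw [← Finset.insert_eq, Finset.insert_erase hmem]
    have key := hP _ (hAB hmem) (A.erase (A.min' hne))
      (fun x hx => ⟨hAB (Finset.mem_of_mem_erase hx), hlt x hx⟩) hlt
    rw [hunion] at key
    exact key hA

end SchreierSets

theorem mainTheorem2 (α : Ordinal.{0}) (hα : Order.IsSuccLimit α)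
    (hα₁ : α < Ordinal.omega 1) :
    (∃ b : Ordinal.{0} → ℕ+ → Ordinal.{0}, SchreierSets.IsCoherentLadder α b) ∧
    ∀ b : Ordinal.{0} → ℕ+ → Ordinal.{0}, SchreierSets.IsCoherentLadder α b →
      ∀ β : Ordinal.{0}, β < α →
      ∀ K : Set (Finset ℕ+), IsCompact K → IsLowerSet K →
        SchreierSets.iteratedDerivedSet K (Ordinal.omega0 ^ β + 1) = ∅ →
      ∀ C : Set ℕ+, C.Infinite →
        ∃ B : Set ℕ+, B ⊆ C ∧ B.Infinite ∧
        ∃ f : ℕ+ → ℕ+, StrictMono f ∧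
        ∀ A ∈ K, SchreierSets.restrict A B ∈ SchreierSets.family b f β := by
  refine ⟨SchreierSets.exists_isCoherentLadder hα₁, fun b hb β hβ K _ hK hKβ C hC => ?_⟩
  obtain ⟨B, hBC, hB, f, hf, h⟩ := SchreierSets.hasLargeTraces hb hβ K hK (fun h => by
    have := SchreierSets.extensionDerivative_subset_iteratedDerivedSet K _ h
    simp [hKβ] at this) C hC
  classical
  refine ⟨B, hBC, hB, f, hf, fun A hA => ?_⟩
  rw [SchreierSets.restrict]
  -- By heredity the trace is itself a member of `K` contained in `B`.
  refine h _ (hK (Finset.filter_subset _ _) hA) fun x hx => ?_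
  exact (Finset.mem_filter.1 hx).2
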